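/- All graphs in the classes below are finite and simple, and a class of graphs is hereditary if it is closed under isomorphism and under taking induced subgraphs. For an infinite word $\alpha=\alpha_1\alpha_2\alpha_3\cdots$ over the positive integers, let $R^\alpha$ be the infinite graph with path vertices $p_1,p_2,\dots$ and star nodes $s_1,s_2,\dots$, in which $p_i$ is adjacent to $p_{i+1}$ for every $i\ge 1$, $s_a$ is adjacent to $p_i$ exactly when $\alpha_i=a$, and there are no other edges. Let $\mathcal{R}^\alpha$ be the class of all finite graphs isomorphic to an induced subgraph of $R^\alpha$. Consider the following words. - $\nu=12\;123\;1234\;12345\cdots$, the concatenation of the blocks $1\,2\cdots b$ for $b=2,3,4,\dots$. - For an integer $q\ge 2$, $\kappa(q)$ is the word whose $n$-th letter is $k(q-1)+j$, where $n=jq^k+mq^{k+1}$ with integers $k,m\ge 0$ and $1\le j\le q-1$. - $\eta=12\,3\,1\,4\,12\,5\,1231\,6\cdots$ is the word whose $n$-th letter is the integer $i$ such that $F_{i+1}$ is the smallest term in the Zeckendorf representation of $n$ as a sum of distinct, non-consecutive Fibonacci numbers from $F_2=1,\ F_3=2,\ F_4=3,\ F_5=5,\dots$. A hereditary class $\mathcal{D}$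 is minimal of unbounded tree-width if the tree-width of the graphs in $\mathcal{D}$ is unbounded, but every hereditary proper subclass of $\mathcal{D}$ has bounded tree-width. **Theorem.** None of the classes $\mathcal{R}^\nu$, $\mathcal{R}^{\kappa(q)}$ (for any integer $q\ge 2$) and $\mathcal{R}^\eta$ contains a hereditary subclass that is minimal of unbounded tree-width. -/

import Mathlib

namespace PathStar

/-! ### Tree-width -/

/-- A tree-decomposition of the graph `G`: a finite tree with a set of vertices of `G`
(a bag) at every node, subject to the three usual conditions. -/
structure TreeDecomposition {V : Type} (G : SimpleGraph V) where
  /-- the nodes of the tree -/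
  Node : Type
  finite_node : Finite Node
  tree : SimpleGraph Node
  isTree : tree.IsTree
  bag : Node → Set V
  exists_mem_bag : ∀ v : V, ∃ t, v ∈ bag t
  exists_edge_bag : ∀ u v : V, G.Adj u v → ∃ t, u ∈ bag t ∧ v ∈ bag t
  connected_bags : ∀ v : V, (tree.induce {t | v ∈ bag t}).Connected

/-- The width of a tree-decomposition: the maximum size of a bag, minus one. -/
noncomputable def TreeDecomposition.width {V : Type} {G : SimpleGraph V}
    (D : TreeDecomposition G) : ℕ :=
  (⨆ t, (D.bag t).ncard) - 1

/-- The tree-width of a finite graph: the least width of a tree-decomposition. -/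
noncomputable def treewidth {V : Type} [Finite V] (G : SimpleGraph V) : ℕ :=
  sInf {k | ∃ D : TreeDecomposition G, D.width = k}

/-! ### Hereditary classes of finite graphs -/

/-- A finite graph, presented on a vertex set `Fin n`. -/
abbrev FinGraph : Type := Σ n : ℕ, SimpleGraph (Fin n)

/-- `IsInducedSubgraph H G`: the finite graph `H` is isomorphic to an induced subgraph of `G`. -/
def IsInducedSubgraph (H G : FinGraph) : Prop :=
  Nonempty (H.2 ↪g G.2)

/-- A class of finite graphs is hereditary if it is closed under induced subgraphs
(and hence under isomorphism). -/
def IsHereditary (C : Set FinGraph) : Prop :=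
  ∀ G ∈ C, ∀ H : FinGraph, IsInducedSubgraph H G → H ∈ C

/-- The tree-width of the graphs in `C` is bounded by a constant. -/
def HasBoundedTreewidth (C : Set FinGraph) : Prop :=
  ∃ k : ℕ, ∀ G ∈ C, treewidth G.2 ≤ k

/-- `C` is a minimal hereditary class of unbounded tree-width: it is hereditary, it has unbounded
tree-width, and every hereditary proper subclass has bounded tree-width. -/
def IsMinimalOfUnboundedTreewidth (C : Set FinGraph) : Prop :=
  IsHereditary C ∧ ¬ HasBoundedTreewidth C ∧
    ∀ D : Set FinGraph, IsHereditary D → D ⊂ C → HasBoundedTreewidth D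

/-! ### Path-star graphs

An infinite word over the positive integers is a function `α : ℕ → ℕ`, the letters being
`α 1, α 2, α 3, …`; the value `α 0` plays no role. -/

/-- The vertices of an infinite path-star graph: the path vertices `p₁, p₂, …` and the
star nodes `s₁, s₂, …`. -/
inductive Vertex : Type
  | path (i : ℕ+) : Vertex
  | star (a : ℕ+) : Vertex

/-- Adjacency in the path-star graph of `α`: `pᵢ` is adjacent to `pᵢ₊₁`, and the star node `sₐ` is
adjacent to `pᵢ` exactly when the `i`-th letter of `α` is `a`. -/
def pathStarAdj (α : ℕ → ℕ) : Vertex → Vertex → Prop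
  | .path i, .path j => (i : ℕ) + 1 = j ∨ (j : ℕ) + 1 = i
  | .path i, .star a => α i = a
  | .star a, .path i => α i = a
  | .star _, .star _ => False

/-- The infinite path-star graph `R^α`. -/
def pathStarGraph (α : ℕ → ℕ) : SimpleGraph Vertex where
  Adj := pathStarAdj α
  symm := ⟨by
    rintro (i | a) (j | b) h
    · exact Or.symm h
    · exact h
    · exact h
    · exact h⟩
  loopless := ⟨by
    rintro (i | a) h
    · rcases h with h | h <;> omega
    · exact h⟩

/-- The path-star hereditary class of `α`: all finite graphs that are isomorphic to an induced
subgraph of `R^α`. -/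
def pathStarClass (α : ℕ → ℕ) : Set FinGraph :=
  {G | Nonempty (G.2 ↪g pathStarGraph α)}

/-! ### The three kinds of words -/

/-- One step in writing down the blocks `1 2 … b`: a pair `(b, l)` says that the current letter
is `l` and lies in the block `1 2 … b`; the successor of `b` is the first letter of the block
`1 2 … (b + 1)`. -/
def arithStep (s : ℕ × ℕ) : ℕ × ℕ :=
  if s.2 < s.1 then (s.1, s.2 + 1) else (s.1 + 1, 1)

/-- The arithmetic word `ν = 12 123 1234 12345 …`. The block `1` is placed at position `0`, so
that the word proper, which starts at position `1`, begins with the block `12`. -/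
def arithWord (n : ℕ) : ℕ :=
  (arithStep^[n] (1, 1)).2

/-- The power word `κ(q)`, for `q ≥ 2`: if `k` is the exponent of the largest power of `q` that
divides `n ≥ 1` and `j` is the last nonzero digit of `n` in base `q`, that is
`n = j * q ^ k + m * q ^ (k + 1)` with `1 ≤ j ≤ q - 1`, then the `n`-th letter is
`k * (q - 1) + j`. -/
def powerWord (q n : ℕ) : ℕ :=
  padicValNat q n * (q - 1) + n / q ^ padicValNat q n % q

/-- The Fibonacci word `η = 12 3 1 4 12 5 1231 6 …`: if `F_{i + 1}` is the smallest term in the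
Zeckendorf representation of `n ≥ 1`, then the `n`-th letter is `i`. Mathlib's
`Nat.zeckendorf n` is the decreasing list of the indices of the Fibonacci numbers used, with
`F₁ = F₂ = 1` and all the indices at least `2`. -/
def fibWord (n : ℕ) : ℕ :=
  n.zeckendorf.getLastD 0 - 1

end PathStar

/-! Let `D` be minimal inside the class of `α`. Deleting the star nodes of index at most m lowers
tree-width by at most m, so the members of `D` that embed without them form a hereditary class of
unbounded tree-width, which by minimality is all of `D`. It then suffices that every `spreadClass α
D g` has unbounded tree-width: it too equals `D`, and with g = |V(G)| no run of path vertices of G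
meets two star nodes, so G has tree-width at most 3 (`treewidth_le_three_of_spread`).

For the power and Fibonacci words, large letters are far apart, so avoiding small star nodes already
forces spread.

For the arithmetic word the star nodes must be thinned. Embed G in `D` with all star indices above
|V(G)|. A run of G is too short to climb back to a used letter after a reset to 1, so between used
letters it reads consecutive integers. Either L segments run through the same L+1 star nodes, or the
tree-width is at most 4L+1 (`exists_window`, from `treewidth_le_of_core`). In the first case,
keeping every (g+1)-st star node leaves a spread graph with a large complete bipartite minor
(`exists_spread_subgraph`). -/

namespace PathStar

/-! ### Trees given by a parent function -/

/-- The graph on `{0, …, N}` in which every `t > 0` is joined to its parent `p t`. -/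
def parentGraph (N : ℕ) (p : ℕ → ℕ) : SimpleGraph (Fin (N + 1)) :=
  SimpleGraph.fromRel fun s t => (0 : ℕ) < t ∧ p t = s

theorem parentGraph_adj {N : ℕ} {p : ℕ → ℕ} (hp : ∀ t, 0 < t → p t < t) {s t : Fin (N + 1)}
    (ht : 0 < (t : ℕ)) (h : p t = s) : (parentGraph N p).Adj s t := by
  refine ⟨?_, Or.inl ⟨ht, h⟩⟩
  rintro rfl
  have := hp _ ht
  omega

theorem parentGraph_induce_connected {N : ℕ} {p : ℕ → ℕ} (hp : ∀ t, 0 < t → p t < t)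
    (S : Set (Fin (N + 1))) (s : Fin (N + 1)) (hs : s ∈ S)
    (hS : ∀ t ∈ S, t ≠ s → 0 < (t : ℕ) ∧ ∃ u ∈ S, (u : ℕ) = p t) :
    ((parentGraph N p).induce S).Connected := by
  have key : ∀ n : ℕ, ∀ t : Fin (N + 1), (t : ℕ) = n → ∀ ht : t ∈ S,
      ((parentGraph N p).induce S).Reachable ⟨t, ht⟩ ⟨s, hs⟩ := by
    intro n
    induction n using Nat.strong_induction_on with
    | _ n ih =>
      intro t htn ht
      by_cases hts : t = s
      · subst hts; rfl
      · obtain ⟨h0, u, hu, hup⟩ := hS t ht hts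
        have hlt : (u : ℕ) < n := by rw [hup, ← htn]; exact hp _ h0
        refine SimpleGraph.Reachable.trans (SimpleGraph.Adj.reachable ?_) (ih u hlt u rfl hu)
        exact (parentGraph_adj hp h0 hup.symm).symm
  rw [SimpleGraph.connected_iff]
  exact ⟨fun x y => (key _ x.1 rfl x.2).trans (key _ y.1 rfl y.2).symm, ⟨⟨s, hs⟩⟩⟩

theorem parentGraph_isTree (N : ℕ) {p : ℕ → ℕ} (hp : ∀ t, 0 < t → p t < t) :
    (parentGraph N p).IsTree := by
  have hconn : (parentGraph N p).Connected := by
    have h := parentGraph_induce_connected (N := N) hp Set.univ 0 trivial (by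
      intro t _ ht
      have h0 : 0 < (t : ℕ) := Nat.pos_of_ne_zero fun h => ht (Fin.ext h)
      exact ⟨h0, ⟨p t, by have := hp _ h0; have := t.2; omega⟩, trivial, rfl⟩)
    exact (SimpleGraph.induceUnivIso (parentGraph N p)).connected_iff.1 h
  rw [SimpleGraph.isTree_iff_connected_and_card]
  refine ⟨hconn, le_antisymm ?_ hconn.card_vert_le_card_edgeSet_add_one⟩
  rw [Nat.card_fin]
  have hlt : ∀ i : Fin N, p (i + 1) < N + 1 := fun i => by
    have := hp (i + 1) (Nat.succ_pos _); have := i.2; omega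
  let g : Fin N → (parentGraph N p).edgeSet := fun i =>
    ⟨s(⟨p (i + 1), hlt i⟩, ⟨i + 1, by have := i.2; omega⟩),
      parentGraph_adj hp (Nat.succ_pos _) rfl⟩
  have hg : Function.Surjective g := by
    have aux : ∀ s t : Fin (N + 1), (0 : ℕ) < t → p t = s → ∃ i, (g i).1 = s(s, t) := by
      intro s t h0 hst
      refine ⟨⟨t - 1, by have := t.2; omega⟩, ?_⟩
      have ht : (t : ℕ) - 1 + 1 = t := by omega
      have h1 : (⟨t - 1 + 1, by have := t.2; omega⟩ : Fin (N + 1)) = t := Fin.ext ht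
      have h2 : (⟨p (t - 1 + 1), by rw [ht, hst]; exact s.2⟩ : Fin (N + 1)) = s :=
        Fin.ext (by simp [ht, hst])
      simp only [g, h1, h2]
    rintro ⟨e, he⟩
    induction e using Sym2.ind with
    | _ s t =>
      rcases he with ⟨_, ⟨h0, h⟩ | ⟨h0, h⟩⟩
      · obtain ⟨i, hi⟩ := aux s t h0 h
        exact ⟨i, Subtype.ext hi⟩
      · obtain ⟨i, hi⟩ := aux t s h0 h
        exact ⟨i, Subtype.ext (hi.trans Sym2.eq_swap)⟩
  have := Nat.card_le_card_of_surjective g hg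
  rw [Nat.card_fin] at this
  omega

/-! ### Bounding tree-width -/

theorem treewidth_le_of_bags {V : Type} [Finite V] {G : SimpleGraph V} (D : TreeDecomposition G)
    {k : ℕ} (h : ∀ t, (D.bag t).ncard ≤ k + 1) : treewidth G ≤ k := by
  have h1 : treewidth G ≤ D.width := Nat.sInf_le ⟨D, rfl⟩
  have : (⨆ t, (D.bag t).ncard) ≤ k + 1 := by
    have := D.isTree.connected.nonempty
    exact ciSup_le h
  unfold TreeDecomposition.width at h1
  omega

/-- The tree-decomposition with a single bag. -/
def trivialDecomposition {V : Type} (G : SimpleGraph V) : TreeDecomposition G where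
  Node := Fin 1
  finite_node := inferInstance
  tree := parentGraph 0 fun _ => 0
  isTree := parentGraph_isTree 0 fun _ h => h
  bag _ := Set.univ
  exists_mem_bag _ := ⟨0, trivial⟩
  exists_edge_bag _ _ _ := ⟨0, trivial, trivial⟩
  connected_bags _ := parentGraph_induce_connected (fun _ h => h) _ 0 trivial
    fun t _ ht => absurd (Fin.ext (by simp)) ht

theorem exists_treeDecomposition {V : Type} [Finite V] (G : SimpleGraph V) :
    ∃ D : TreeDecomposition G, ∀ t, (D.bag t).ncard ≤ treewidth G + 1 := by
  obtain ⟨D, hD⟩ : ∃ D : TreeDecomposition G, D.width = treewidth G :=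
    Nat.sInf_mem (s := {k | ∃ D : TreeDecomposition G, D.width = k}) ⟨_, trivialDecomposition G, rfl⟩
  refine ⟨D, fun t => ?_⟩
  have := D.finite_node
  have h := le_ciSup (Set.finite_range fun t => (D.bag t).ncard).bddAbove t
  rw [← hD]
  unfold TreeDecomposition.width
  omega

/-- The vertices missed by `e` are added to every bag. -/
theorem treewidth_le_add_of_embedding {V W : Type} [Finite V] [Finite W] {G : SimpleGraph V}
    {H : SimpleGraph W} (e : H ↪g G) {m : ℕ} (hm : (Set.range e)ᶜ.ncard ≤ m) :
    treewidth G ≤ treewidth H + m := by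
  obtain ⟨D, hD⟩ := exists_treeDecomposition H
  have htop := D.isTree.connected
  have hne := htop.nonempty
  have huniv : ∀ v ∉ Set.range e, {t | v ∈ e '' D.bag t ∪ (Set.range e)ᶜ} = Set.univ := by
    intro v hv
    ext t
    simp only [Set.mem_univ, iff_true]
    exact Or.inr hv
  have himg : ∀ w, {t | e w ∈ e '' D.bag t ∪ (Set.range e)ᶜ} = {t | w ∈ D.bag t} := by
    intro w
    ext t
    simp [e.injective.eq_iff]
  let D' : TreeDecomposition G :=
    { Node := D.Node
      finite_node := D.finite_node
      tree := D.tree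
      isTree := D.isTree
      bag := fun t => e '' D.bag t ∪ (Set.range e)ᶜ
      exists_mem_bag := by
        intro v
        by_cases hv : v ∈ Set.range e
        · obtain ⟨w, rfl⟩ := hv
          obtain ⟨t, ht⟩ := D.exists_mem_bag w
          exact ⟨t, Or.inl ⟨w, ht, rfl⟩⟩
        · exact ⟨hne.some, Or.inr hv⟩
      exists_edge_bag := by
        intro u v huv
        by_cases hu : u ∈ Set.range e
        · obtain ⟨u', rfl⟩ := hu
          by_cases hv : v ∈ Set.range e
          · obtain ⟨v', rfl⟩ := hv
            obtain ⟨t, ht⟩ := D.exists_edge_bag u' v' (e.map_adj_iff.1 huv)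
            exact ⟨t, Or.inl ⟨u', ht.1, rfl⟩, Or.inl ⟨v', ht.2, rfl⟩⟩
          · obtain ⟨t, ht⟩ := D.exists_mem_bag u'
            exact ⟨t, Or.inl ⟨u', ht, rfl⟩, Or.inr hv⟩
        · by_cases hv : v ∈ Set.range e
          · obtain ⟨v', rfl⟩ := hv
            obtain ⟨t, ht⟩ := D.exists_mem_bag v'
            exact ⟨t, Or.inr hu, Or.inl ⟨v', ht, rfl⟩⟩
          · exact ⟨hne.some, Or.inr hu, Or.inr hv⟩
      connected_bags := by
        intro v
        by_cases hv : v ∈ Set.range e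
        · obtain ⟨w, rfl⟩ := hv
          rw [himg]
          exact D.connected_bags w
        · rw [huniv v hv]
          exact (SimpleGraph.induceUnivIso D.tree).connected_iff.2 htop }
  refine treewidth_le_of_bags D' fun t => ?_
  calc (D'.bag t).ncard ≤ (e '' D.bag t).ncard + (Set.range e)ᶜ.ncard := Set.ncard_union_le _ _
    _ ≤ (D.bag t).ncard + m := Nat.add_le_add (Set.ncard_image_le) hm
    _ ≤ treewidth H + m + 1 := by have := hD t; omega

theorem exists_finGraph_embedding (G : FinGraph) (S : Set (Fin G.1)) :
    ∃ (H : FinGraph) (e : H.2 ↪g G.2), Set.range e = S := by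
  obtain ⟨n, ⟨φ⟩⟩ := Finite.exists_equiv_fin S
  refine ⟨⟨n, (G.2.induce S).comap φ.symm⟩,
    (SimpleGraph.Embedding.induce S).comp (SimpleGraph.Iso.comap φ.symm _).toEmbedding, ?_⟩
  ext x
  constructor
  · rintro ⟨y, rfl⟩
    exact (φ.symm y).2
  · intro hx
    exact ⟨φ ⟨x, hx⟩, by
      change ((φ.symm (φ ⟨x, hx⟩) : S) : Fin G.1) = x
      rw [φ.symm_apply_apply]⟩

/-! ### A general upper bound -/

/-- If the vertices outside `core` induce disjoint paths along `pos`, and the neighbourhoods of the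
paths in the core as well as the edges of the core stay in two consecutive blocks, then the
tree-width is bounded in terms of the sizes of the blocks. -/
theorem treewidth_le_of_run_label {V : Type} [Finite V] (G : SimpleGraph V) (core : Set V)
    (blk pos : V → ℕ) (cr : ℕ → ℕ) (M B : ℕ) (hinj : Set.InjOn pos coreᶜ)
    (hpath : ∀ u ∉ core, ∀ v ∉ core, G.Adj u v → pos u + 1 = pos v ∨ pos v + 1 = pos u)
    (hcore : ∀ u ∈ core, ∀ v ∈ core, G.Adj u v → blk v ≤ blk u + 1)
    (hcr : ∀ u ∉ core, ∀ v ∉ core, pos u + 1 = pos v → cr (pos u) = cr (pos v))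
    (hB : ∀ i, cr i ≤ B) (hblk : ∀ v, blk v ≤ B)
    (hatt : ∀ u ∉ core, ∀ x ∈ core, G.Adj u x → blk x = cr (pos u) ∨ blk x = cr (pos u) + 1)
    (hM : ∀ c, {v | v ∈ core ∧ blk v = c}.ncard ≤ M) :
    treewidth G ≤ 2 * M + 1 := by
  classical
  obtain ⟨P, hP⟩ : ∃ P, ∀ v, pos v ≤ P := by
    obtain ⟨P, hP⟩ := (Set.finite_range pos).bddAbove
    exact ⟨P, fun v => hP ⟨v, rfl⟩⟩
  let two : ℕ → Set V := fun c => {v | v ∈ core ∧ (blk v = c ∨ blk v = c + 1)}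
  have htwo : ∀ c, (two c).ncard ≤ 2 * M := by
    intro c
    have : two c = {v | v ∈ core ∧ blk v = c} ∪ {v | v ∈ core ∧ blk v = c + 1} := by
      ext v; simp only [two, Set.mem_ofPred_eq, Set.mem_union]; tauto
    rw [this]
    refine (Set.ncard_union_le _ _).trans ?_
    have := hM c; have := hM (c + 1); omega
  -- The tree has a spine 0, …, B, whose node c carries the core blocks c and c+1. Node B+1+i stands
  -- for position i: each run of occupied positions hangs as a path from spine node `cr`, and an
  -- unoccupied position is a leaf with empty bag.
  let free : ℕ → Prop := fun i => ∃ v, v ∉ core ∧ pos v = i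
  let bag : ℕ → Set V := fun t =>
    if t ≤ B then two t else
      if free (t - (B + 1)) then
        two (cr (t - (B + 1))) ∪
          {v | v ∉ core ∧ (pos v = t - (B + 1) ∨ (pos v = t - (B + 1) + 1))}
      else ∅
  let par : ℕ → ℕ := fun t =>
    if t ≤ B then t - 1 else
      -- Without the first condition, truncated subtraction would make position 0 its own
      -- predecessor and hang it from spine node B.
      if B + 1 < t ∧ free (t - (B + 1)) ∧ free (t - (B + 1) - 1) then t - 1
      else cr (t - (B + 1))
  have hpar : ∀ t, 0 < t → par t < t := by
    intro t ht
    simp only [par]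
    split_ifs with h1 h2
    · omega
    · omega
    · have := hB (t - (B + 1)); omega
  have bag_main : ∀ c, c ≤ B → bag c = two c := fun c hc => by simp only [bag, if_pos hc]
  have bag_run : ∀ i, free i → bag (B + 1 + i) =
      two (cr i) ∪ {v | v ∉ core ∧ (pos v = i ∨ (pos v = i + 1))} := by
    intro i hi
    have h1 : ¬ (B + 1 + i ≤ B) := by omega
    have h2 : B + 1 + i - (B + 1) = i := by omega
    simp only [bag, if_neg h1, h2, if_pos hi]
  have bag_dead : ∀ i, ¬ free i → bag (B + 1 + i) = ∅ := by
    intro i hi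
    have h1 : ¬ (B + 1 + i ≤ B) := by omega
    have h2 : B + 1 + i - (B + 1) = i := by omega
    simp only [bag, if_neg h1, h2, if_neg hi]
  have par_run : ∀ i, par (B + 1 + i) = if 0 < i ∧ free i ∧ free (i - 1) then B + 1 + i - 1
      else cr i := by
    intro i
    have h1 : ¬ (B + 1 + i ≤ B) := by omega
    have h2 : B + 1 + i - (B + 1) = i := by omega
    have h3 : B + 1 < B + 1 + i ↔ 0 < i := by omega
    simp only [par, if_neg h1, h2, h3]
  have par_main : ∀ c, c ≤ B → par c = c - 1 := fun c hc => by simp only [par, if_pos hc]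
  have hsplit : ∀ t, t ≤ B ∨ ∃ i, t = B + 1 + i := fun t => by
    rcases Nat.lt_or_ge B t with h | h
    · exact Or.inr ⟨t - (B + 1), by omega⟩
    · exact Or.inl h
  let N := B + 1 + P
  have hposN : ∀ v, B + 1 + pos v < N + 1 := fun v => by have := hP v; simp only [N]; omega
  let D : TreeDecomposition G :=
    { Node := Fin (N + 1)
      finite_node := inferInstance
      tree := parentGraph N par
      isTree := parentGraph_isTree N hpar
      bag := fun t => bag t
      exists_mem_bag := by
        intro v
        by_cases hv : v ∈ core
        · refine ⟨⟨blk v, by have := hblk v; simp only [N]; omega⟩, ?_⟩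
          show v ∈ bag (blk v)
          rw [bag_main _ (hblk v)]
          exact ⟨hv, Or.inl rfl⟩
        · refine ⟨⟨B + 1 + pos v, hposN v⟩, ?_⟩
          show v ∈ bag (B + 1 + pos v)
          rw [bag_run _ ⟨v, hv, rfl⟩]
          exact Or.inr ⟨hv, Or.inl rfl⟩
      exists_edge_bag := by
        have hcc : ∀ u ∈ core, ∀ v ∈ core, G.Adj u v → blk u ≤ blk v →
            ∃ t : Fin (N + 1), u ∈ bag t ∧ v ∈ bag t := by
          intro u hu v hv h hle
          have h1 := hcore u hu v hv h
          refine ⟨⟨blk u, by have := hblk u; simp only [N]; omega⟩, ?_⟩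
          simp only [bag_main _ (hblk u)]
          exact ⟨⟨hu, Or.inl rfl⟩, ⟨hv, by omega⟩⟩
        have hfc : ∀ u ∉ core, ∀ v ∈ core, G.Adj u v →
            ∃ t : Fin (N + 1), u ∈ bag t ∧ v ∈ bag t := by
          intro u hu v hv h
          refine ⟨⟨B + 1 + pos u, hposN u⟩, ?_⟩
          simp only [bag_run _ ⟨u, hu, rfl⟩]
          exact ⟨Or.inr ⟨hu, Or.inl rfl⟩, Or.inl ⟨hv, hatt u hu v hv h⟩⟩
        have hff : ∀ u ∉ core, ∀ v ∉ core, pos u + 1 = pos v →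
            ∃ t : Fin (N + 1), u ∈ bag t ∧ v ∈ bag t := by
          intro u hu v hv h
          refine ⟨⟨B + 1 + pos u, hposN u⟩, ?_⟩
          simp only [bag_run _ ⟨u, hu, rfl⟩]
          exact ⟨Or.inr ⟨hu, Or.inl rfl⟩, Or.inr ⟨hv, Or.inr h.symm⟩⟩
        intro u v h
        by_cases hu : u ∈ core <;> by_cases hv : v ∈ core
        · rcases le_total (blk u) (blk v) with hle | hle
          · exact hcc u hu v hv h hle
          · obtain ⟨t, h1, h2⟩ := hcc v hv u hu h.symm hle
            exact ⟨t, h2, h1⟩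
        · obtain ⟨t, h1, h2⟩ := hfc v hv u hu h.symm
          exact ⟨t, h2, h1⟩
        · exact hfc u hu v hv h
        · rcases hpath u hu v hv h with hp | hp
          · exact hff u hu v hv hp
          · obtain ⟨t, h1, h2⟩ := hff v hv u hu hp
            exact ⟨t, h2, h1⟩
      connected_bags := by
        intro v
        by_cases hv : v ∈ core
        -- The root of the subtree of v; truncated subtraction gives node 0 for block 0, as it
        -- should.
        · have htop : v ∈ two (blk v - 1) := ⟨hv, by omega⟩
          refine parentGraph_induce_connected hpar _
            ⟨blk v - 1, by have := hblk v; simp only [N]; omega⟩ ?_ ?_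
          · show v ∈ bag (blk v - 1)
            rwa [bag_main _ (by have := hblk v; omega)]
          · rintro ⟨t, htN⟩ (ht : v ∈ bag t) hne
            have hne' : t ≠ blk v - 1 := fun h => hne (Fin.ext h)
            suffices h : 0 < t ∧ v ∈ bag (par t) by
              exact ⟨h.1, ⟨par t, (hpar t h.1).trans htN⟩, h.2, rfl⟩
            rcases hsplit t with h | ⟨i, rfl⟩
            · rw [bag_main _ h] at ht
              have h1 := ht.2
              refine ⟨by omega, ?_⟩
              rw [par_main _ h, bag_main _ (by omega)]
              exact ⟨hv, by omega⟩
            · refine ⟨by omega, ?_⟩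
              by_cases hi : free i
              · rw [bag_run i hi] at ht
                have ht' : v ∈ two (cr i) := by
                  rcases ht with ht | ht
                  · exact ht
                  · exact absurd hv ht.1
                rw [par_run]
                split_ifs with hc
                · obtain ⟨h0, ⟨u, hu, hui⟩, ⟨w, hw, hwi⟩⟩ := hc
                  have e : B + 1 + i - 1 = B + 1 + (i - 1) := by omega
                  rw [e, bag_run _ ⟨w, hw, hwi⟩]
                  have := hcr w hw u hu (by omega)
                  rw [← hwi, this, hui]
                  exact Or.inl ht'
                · rwa [bag_main _ (hB i)]
              · rw [bag_dead i hi] at ht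
                exact absurd ht (Set.notMem_empty _)
        · have hfv : free (pos v) := ⟨v, hv, rfl⟩
          have hmem : ∀ t, v ∈ bag t → ∃ i, t = B + 1 + i ∧ free i ∧
              (pos v = i ∨ pos v = i + 1) := by
            intro t ht
            rcases hsplit t with h | ⟨i, rfl⟩
            · rw [bag_main _ h] at ht
              exact absurd ht.1 hv
            · by_cases hi : free i
              · rw [bag_run i hi] at ht
                rcases ht with ht | ht
                · exact absurd ht.1 hv
                · exact ⟨i, rfl, hi, ht.2⟩
              · rw [bag_dead i hi] at ht
                exact absurd ht (Set.notMem_empty _)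
          -- If the preceding position is occupied, its bag also contains v and is the root of the
          -- subtree of v.
          by_cases hc : 0 < pos v ∧ free (pos v - 1)
          · have hb : v ∈ bag (B + 1 + (pos v - 1)) := by
              rw [bag_run _ hc.2]
              exact Or.inr ⟨hv, by omega⟩
            refine parentGraph_induce_connected hpar _
              ⟨B + 1 + (pos v - 1), by have := hposN v; omega⟩ hb ?_
            rintro ⟨t, htN⟩ (ht : v ∈ bag t) hne
            obtain ⟨i, rfl, hi, h⟩ := hmem t ht
            have hne' : i ≠ pos v - 1 := fun h => hne (Fin.ext (by simp [h]))
            have hiv : i = pos v := by omega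
            refine ⟨by simp only; omega, ⟨B + 1 + (pos v - 1), by have := hposN v; omega⟩, hb, ?_⟩
            simp only
            rw [par_run, hiv, if_pos ⟨hc.1, hfv, hc.2⟩]
            omega
          · refine parentGraph_induce_connected hpar _ ⟨B + 1 + pos v, hposN v⟩ ?_ ?_
            · show v ∈ bag _
              rw [bag_run _ hfv]
              exact Or.inr ⟨hv, Or.inl rfl⟩
            · rintro ⟨t, htN⟩ (ht : v ∈ bag t) hne
              obtain ⟨i, rfl, hi, h⟩ := hmem t ht
              have hne' : i ≠ pos v := fun h => hne (Fin.ext (by simp [h]))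
              exfalso
              apply hc
              have : i = pos v - 1 := by omega
              rw [← this]
              exact ⟨by omega, hi⟩ }
  refine treewidth_le_of_bags D ?_
  rintro ⟨t, htN⟩
  show (bag t).ncard ≤ 2 * M + 1 + 1
  have hone : ∀ i, {v | v ∉ core ∧ pos v = i}.ncard ≤ 1 := by
    intro i
    rw [Set.ncard_le_one]
    rintro a ⟨ha, ha'⟩ b ⟨hb, hb'⟩
    exact hinj ha hb (ha'.trans hb'.symm)
  rcases hsplit t with h | ⟨i, rfl⟩
  · rw [bag_main _ h]
    have := htwo t
    omega
  · by_cases hi : free i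
    · rw [bag_run i hi]
      refine (Set.ncard_union_le _ _).trans ?_
      have h1 := htwo (cr i)
      have h2 : {v | v ∉ core ∧ (pos v = i ∨ pos v = i + 1)}.ncard ≤ 2 := by
        have : {v | v ∉ core ∧ (pos v = i ∨ pos v = i + 1)} =
            {v | v ∉ core ∧ pos v = i} ∪ {v | v ∉ core ∧ pos v = i + 1} := by
          ext v; simp only [Set.mem_ofPred_eq, Set.mem_union]; tauto
        rw [this]
        refine (Set.ncard_union_le _ _).trans ?_
        have := hone i; have := hone (i + 1); omega
      omega
    · rw [bag_dead i hi]
      simp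

/-- Each run is labelled with the least block attached to it; by `hpair` every other attached block
exceeds it by at most one. -/
theorem treewidth_le_of_core {V : Type} [Finite V] (G : SimpleGraph V) (core : Set V)
    (blk pos : V → ℕ) (M : ℕ) (hinj : Set.InjOn pos coreᶜ)
    (hpath : ∀ u ∉ core, ∀ v ∉ core, G.Adj u v → pos u + 1 = pos v ∨ pos v + 1 = pos u)
    (hcore : ∀ u ∈ core, ∀ v ∈ core, G.Adj u v → blk v ≤ blk u + 1)
    (hpair : ∀ u ∉ core, ∀ v ∉ core,
      (∀ k, min (pos u) (pos v) ≤ k → k ≤ max (pos u) (pos v) → ∃ w ∉ core, pos w = k) →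
      ∀ x ∈ core, ∀ y ∈ core, G.Adj u x → G.Adj v y → blk y ≤ blk x + 1)
    (hM : ∀ c, {v | v ∈ core ∧ blk v = c}.ncard ≤ M) :
    treewidth G ≤ 2 * M + 1 := by
  obtain ⟨B, hB⟩ : ∃ B, ∀ v, blk v ≤ B := by
    obtain ⟨B, hB⟩ := (Set.finite_range blk).bddAbove
    exact ⟨B, fun v => hB ⟨v, rfl⟩⟩
  let run : ℕ → ℕ → Prop := fun i j => ∀ k, min i j ≤ k → k ≤ max i j → ∃ w ∉ core, pos w = k
  let A : ℕ → Set ℕ := fun i =>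
    {b | ∃ u ∉ core, ∃ x ∈ core, G.Adj u x ∧ run (pos u) i ∧ blk x = b}
  have hrun : ∀ i j l, run i j → run j l → run i l := by
    intro i j l h1 h2 k hk1 hk2
    by_cases h : min i j ≤ k ∧ k ≤ max i j
    · exact h1 k h.1 h.2
    · exact h2 k (by omega) (by omega)
  have hsymm : ∀ i j, run i j → run j i := fun i j h k h1 h2 => h k (by omega) (by omega)
  have hstep : ∀ u ∉ core, ∀ v ∉ core, pos u + 1 = pos v → run (pos u) (pos v) := by
    intro u hu v hv h k h1 h2
    by_cases hk : k = pos u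
    · exact ⟨u, hu, hk.symm⟩
    · exact ⟨v, hv, by omega⟩
  refine treewidth_le_of_run_label G core blk pos (fun i => sInf (A i)) M B hinj hpath hcore
    ?_ ?_ hB ?_ hM
  · intro u hu v hv h
    have hr := hstep u hu v hv h
    have : A (pos u) = A (pos v) := by
      ext b
      constructor
      · rintro ⟨w, hw, x, hx, hwx, h1, h2⟩
        exact ⟨w, hw, x, hx, hwx, hrun _ _ _ h1 hr, h2⟩
      · rintro ⟨w, hw, x, hx, hwx, h1, h2⟩
        exact ⟨w, hw, x, hx, hwx, hrun _ _ _ h1 (hsymm _ _ hr), h2⟩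
    simp only [this]
  · intro i
    by_cases h : (A i).Nonempty
    · obtain ⟨u, _, x, _, _, _, hb⟩ := Nat.sInf_mem h
      rw [← hb]
      exact hB x
    -- A run with no neighbour in the core gets the label `sInf ∅ = 0`.
    · rw [Set.not_nonempty_iff_eq_empty.1 h]
      simp
  · intro u hu x hx hux
    have hmem : blk x ∈ A (pos u) :=
      ⟨u, hu, x, hx, hux, fun k h1 h2 => ⟨u, hu, by omega⟩, rfl⟩
    have hle := Nat.sInf_le hmem
    obtain ⟨w, hw, y, hy, hwy, hr, hb⟩ := Nat.sInf_mem ⟨_, hmem⟩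
    have := hpair w hw u hu hr y hy x hx hwy hux
    omega

/-! ### A lower bound -/

/-- A path inside S to its top m, followed by a geodesic from m to the root: past m the geodesic is
nearer to the root than any node of S, so no node repeats. -/
theorem exists_path_through_top {N : Type} {T : SimpleGraph N} (hT : T.IsTree) (r : N)
    {S : Set N} (hS : (T.induce S).Connected) {m : N} (hm : m ∈ S)
    (hmin : ∀ x ∈ S, T.dist m r ≤ T.dist x r) {x : N} (hx : x ∈ S) :
    ∃ p : T.Walk x r, p.IsPath ∧ m ∈ p.support ∧
      ∀ y ∈ p.support, y ∈ S ∨ T.dist y r < T.dist m r := by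
  obtain ⟨a, ha⟩ := (hS.preconnected ⟨x, hx⟩ ⟨m, hm⟩).exists_isPath
  let φ := (SimpleGraph.Embedding.induce (G := T) S).toHom
  let a' : T.Walk x m := a.map φ
  have ha' : a'.IsPath := ha.map Subtype.val_injective
  have haS : ∀ y ∈ a'.support, y ∈ S := by
    intro y hy
    have hy' : y ∈ (a.map φ).support := hy
    rw [SimpleGraph.Walk.support_map] at hy'
    obtain ⟨z, _, rfl⟩ := List.mem_map.1 hy'
    exact z.2
  obtain ⟨b, hb, hbl⟩ := hT.connected.exists_path_of_dist m r
  have hbd : ∀ y ∈ b.support, y = m ∨ T.dist y r < T.dist m r := by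
    classical
    intro y hy
    by_cases hym : y = m
    · exact Or.inl hym
    · right
      have h1 := congrArg SimpleGraph.Walk.length (b.take_spec hy)
      rw [SimpleGraph.Walk.length_append] at h1
      have h2 := SimpleGraph.dist_le (b.dropUntil y hy)
      have h3 : (b.takeUntil y hy).length ≠ 0 := fun h =>
        hym (SimpleGraph.Walk.eq_of_length_eq_zero h).symm
      omega
  refine ⟨a'.append b, ?_, ?_, ?_⟩
  · rw [SimpleGraph.Walk.isPath_def, SimpleGraph.Walk.support_append]
    have hbn := hb.support_nodup
    rw [← SimpleGraph.Walk.cons_tail_support] at hbn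
    refine List.nodup_append.2 ⟨ha'.support_nodup, (List.nodup_cons.1 hbn).2, ?_⟩
    rintro y hy z hz rfl
    have hym : y ≠ m := by
      rintro rfl
      exact (List.nodup_cons.1 hbn).1 hz
    rcases hbd y (List.mem_of_mem_tail hz) with h | h
    · exact hym h
    · have := hmin y (haS y hy)
      omega
  · rw [SimpleGraph.Walk.mem_support_append_iff]
    exact Or.inl a'.end_mem_support
  · intro y hy
    rw [SimpleGraph.Walk.mem_support_append_iff] at hy
    rcases hy with hy | hy
    · exact Or.inl (haS y hy)
    · rcases hbd y hy with rfl | h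
      · exact Or.inl hm
      · exact Or.inr h

/-- If two subtrees of a rooted tree intersect, then the deeper one of their top nodes lies in
both. -/
theorem top_mem_of_inter {N : Type} {T : SimpleGraph N} (hT : T.IsTree) (r : N)
    {S S' : Set N} (hS : (T.induce S).Connected) (hS' : (T.induce S').Connected) {m m' : N}
    (hm : m ∈ S) (hmin : ∀ x ∈ S, T.dist m r ≤ T.dist x r)
    (hm' : m' ∈ S') (hmin' : ∀ x ∈ S', T.dist m' r ≤ T.dist x r)
    (hle : T.dist m' r ≤ T.dist m r) (h : (S ∩ S').Nonempty) : m ∈ S' := by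
  obtain ⟨x, hx, hx'⟩ := h
  obtain ⟨p, hp, hmp, _⟩ := exists_path_through_top hT r hS hm hmin hx
  obtain ⟨q, hq, _, hqS⟩ := exists_path_through_top hT r hS' hm' hmin' hx'
  have hpq : p = q := congrArg Subtype.val
    ((hT.isAcyclic.subsingleton_path _ _).elim ⟨p, hp⟩ ⟨q, hq⟩)
  subst hpq
  rcases hqS m hmp with h | h
  · exact h
  · omega

theorem connected_induce_iUnion_bags {V : Type} {G : SimpleGraph V} (D : TreeDecomposition G)
    {Q : Set V} (hQ : (G.induce Q).Connected) :
    (D.tree.induce {t | ∃ v ∈ Q, v ∈ D.bag t}).Connected := by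
  set U : Set D.Node := {t | ∃ v ∈ Q, v ∈ D.bag t} with hU
  have hsame : ∀ v (hv : v ∈ Q) s t (hs : v ∈ D.bag s) (ht : v ∈ D.bag t),
      (D.tree.induce U).Reachable ⟨s, v, hv, hs⟩ ⟨t, v, hv, ht⟩ := by
    intro v hv s t hs ht
    have h := (D.connected_bags v).preconnected ⟨s, hs⟩ ⟨t, ht⟩
    exact h.map (SimpleGraph.induceHomOfLE D.tree
      (fun _ h' => ⟨v, hv, h'⟩ : {t | v ∈ D.bag t} ≤ U)).toHom
  have hwalk : ∀ u v : Q, (G.induce Q).Walk u v → ∀ s t (hs : u.1 ∈ D.bag s) (ht : v.1 ∈ D.bag t),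
      (D.tree.induce U).Reachable ⟨s, u, u.2, hs⟩ ⟨t, v, v.2, ht⟩ := by
    intro u v p
    induction p with
    | nil => exact fun s t hs ht => hsame _ (Subtype.prop _) s t hs ht
    | @cons u w v hadj _ ih =>
      intro s t hs ht
      obtain ⟨z, hz1, hz2⟩ := D.exists_edge_bag u.1 w.1 hadj
      exact (hsame _ u.2 s z hs hz1).trans (ih z t hz2 ht)
  rw [SimpleGraph.connected_iff]
  constructor
  · rintro ⟨s, u, hu, hs⟩ ⟨t, v, hv, ht⟩
    obtain ⟨p⟩ := hQ.preconnected ⟨u, hu⟩ ⟨v, hv⟩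
    exact hwalk _ _ p s t hs ht
  · obtain ⟨v, hv⟩ := hQ.nonempty
    obtain ⟨t, ht⟩ := D.exists_mem_bag v
    exact ⟨⟨t, v, hv, ht⟩⟩

/-- Every `Q i` and every `s j` occupies a subtree, and subtrees on opposite sides intersect. The
deepest of all the tops lies in every subtree of the opposite side, so its bag contains L distinct
vertices. -/
theorem le_treewidth_of_completeBipartite_minor {V : Type} [Finite V] (G : SimpleGraph V) {L : ℕ}
    (Q : Fin L → Set V) (hQ : ∀ i, (G.induce (Q i)).Connected)
    (hdisj : ∀ i j, ∀ v ∈ Q i, v ∈ Q j → i = j) (s : Fin L → V) (hs : Function.Injective s)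
    (hadj : ∀ i j, ∃ q ∈ Q i, G.Adj q (s j)) : L ≤ treewidth G + 1 := by
  rcases Nat.eq_zero_or_pos L with h0 | hL
  · omega
  obtain ⟨D, hD⟩ := exists_treeDecomposition G
  let r : D.Node := D.isTree.connected.nonempty.some
  let F : Fin L ⊕ Fin L → Set D.Node :=
    Sum.elim (fun i => {t | ∃ v ∈ Q i, v ∈ D.bag t}) (fun j => {t | s j ∈ D.bag t})
  have hF : ∀ a, (D.tree.induce (F a)).Connected := by
    rintro (i | j)
    · exact connected_induce_iUnion_bags D (hQ i)
    · exact D.connected_bags (s j)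
  have htop : ∀ a, ∃ m ∈ F a, ∀ x ∈ F a, D.tree.dist m r ≤ D.tree.dist x r := by
    intro a
    obtain ⟨⟨x, hx⟩⟩ := (hF a).nonempty
    have hne : (F a).Nonempty := ⟨x, hx⟩
    have := D.finite_node
    obtain ⟨m, hm, hmin⟩ := (Set.toFinite (F a)).exists_minimalFor (fun x => D.tree.dist x r) _ hne
    refine ⟨m, hm, fun y hy => ?_⟩
    rcases le_total (D.tree.dist m r) (D.tree.dist y r) with h | h
    · exact h
    · exact hmin hy h
  choose top htop hmin using htop
  have : Nonempty (Fin L ⊕ Fin L) := ⟨Sum.inl ⟨0, hL⟩⟩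
  obtain ⟨a, ha⟩ := Finite.exists_max fun a => D.tree.dist (top a) r
  have hmeet : ∀ i j, (F (Sum.inl i) ∩ F (Sum.inr j)).Nonempty := by
    intro i j
    obtain ⟨q, hq, hqs⟩ := hadj i j
    obtain ⟨t, h1, h2⟩ := D.exists_edge_bag _ _ hqs
    exact ⟨t, ⟨q, hq, h1⟩, h2⟩
  have hmem : ∀ b, (F a ∩ F b).Nonempty → top a ∈ F b := fun b h =>
    top_mem_of_inter D.isTree r (hF a) (hF b) (htop a) (hmin a) (htop b) (hmin b) (ha b) h
  suffices h : ∃ f : Fin L → V, Function.Injective f ∧ ∀ i, f i ∈ D.bag (top a) by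
    obtain ⟨f, hf, hfb⟩ := h
    have h1 : (Set.range f).ncard = L := by
      rw [Set.ncard_range_of_injective hf, Nat.card_fin]
    have h2 := Set.ncard_le_ncard (Set.range_subset_iff.2 hfb)
    have := hD (top a)
    omega
  rcases a with i | j
  · exact ⟨s, hs, fun j => hmem (Sum.inr j) (hmeet i j)⟩
  · have h : ∀ i, ∃ v ∈ Q i, v ∈ D.bag (top (Sum.inr j)) := fun i =>
      hmem (Sum.inl i) (by rw [Set.inter_comm]; exact hmeet i j)
    choose f hf hfb using h
    exact ⟨f, fun i i' hii => hdisj i i' (f i) (hf i) (hii ▸ hf i'), hfb⟩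

/-! ### The three words -/

/-- Each step adds 1 or resets the letter to 1, and after a reset within d steps the letter is at
most d. -/
theorem arithWord_add (i d : ℕ) :
    arithWord (i + d) = arithWord i + d ∨ arithWord (i + d) ≤ d := by
  have hstep : ∀ n, arithWord (n + 1) = arithWord n + 1 ∨ arithWord (n + 1) = 1 := by
    intro n
    unfold arithWord
    rw [Function.iterate_succ_apply']
    generalize arithStep^[n] (1, 1) = s
    unfold arithStep
    split_ifs
    · exact Or.inl rfl
    · exact Or.inr rfl
  induction d with
  | zero => exact Or.inl rfl
  | succ d ih =>
    rw [← Nat.add_assoc]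
    have := hstep (i + d)
    omega

/-- Large letters of the word `α` are far apart. -/
def LargeLettersSpread (α : ℕ → ℕ) : Prop :=
  ∀ g, ∃ m, ∀ i j, 0 < i → i < j → m < α i → m < α j → i + g < j

/-- If the valuation is v < g, the letter is at most v(q-1) + (q-1) ≤ g(q-1). Primality of q plays
no role. -/
theorem pow_dvd_of_lt_powerWord {q g n : ℕ} (hq : 2 ≤ q) (hn : 0 < n)
    (h : g * (q - 1) < powerWord q n) : q ^ g ∣ n := by
  rw [padicValNat_dvd_iff_le_of_ne_one (by omega) (by omega)]
  by_contra hlt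
  have h1 : n / q ^ padicValNat q n % q < q := Nat.mod_lt _ (by omega)
  have h2 : (padicValNat q n + 1) * (q - 1) ≤ g * (q - 1) := Nat.mul_le_mul_right _ (by omega)
  rw [Nat.add_mul] at h2
  unfold powerWord at h
  omega

theorem largeLettersSpread_powerWord {q : ℕ} (hq : 2 ≤ q) :
    LargeLettersSpread (powerWord q) := by
  intro g
  refine ⟨g * (q - 1), fun i j hi hij h1 h2 => ?_⟩
  have h3 := pow_dvd_of_lt_powerWord hq hi h1
  have h4 := pow_dvd_of_lt_powerWord hq (hi.trans hij) h2
  have h5 := Nat.le_of_dvd (by omega) (Nat.dvd_sub h4 h3)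
  have h6 : g < q ^ g := Nat.lt_pow_self (by omega)
  omega

/-- Telescoping: the tail below the leading index b is bounded by F_{b-1} - F_{M-1}, and F_b +
F_{b-1} = F_{b+1} ≤ F_a. The weak condition M ≤ a+1 lets the induction pass to a = b-1. -/
theorem sum_fib_add_le {M : ℕ} (hM : 1 ≤ M) (l : List ℕ) (hl : l.IsZeckendorfRep)
    (hlM : ∀ x ∈ l, M ≤ x) (a : ℕ) (ha : M ≤ a + 1) (hla : ∀ x ∈ l, x < a) :
    (l.map Nat.fib).sum + Nat.fib (M - 1) ≤ Nat.fib a := by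
  induction l generalizing a with
  | nil => simpa using Nat.fib_mono (by omega)
  | cons b l ih =>
    have hb := hla b (by simp)
    have hbM := hlM b (by simp)
    have hl' : (∀ x ∈ l, x + 2 ≤ b) ∧ l.IsZeckendorfRep := by
      unfold List.IsZeckendorfRep at hl ⊢
      rw [List.cons_append, List.isChain_cons] at hl
      refine ⟨fun x hx => ?_, hl.2⟩
      have hp : (b :: (l ++ [0])).Pairwise (fun a b => b + 2 ≤ a) := by
        have : IsTrans ℕ (fun a b => b + 2 ≤ a) := ⟨fun a b c h1 h2 => by omega⟩
        rw [← List.isChain_iff_pairwise, List.isChain_cons]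
        exact hl
      exact (List.pairwise_cons.1 hp).1 x (by simp [hx])
    have h := ih hl'.2 (fun x hx => hlM x (by simp [hx])) (b - 1) (by omega)
      (fun x hx => by have := hl'.1 x hx; omega)
    have hfib : Nat.fib (b + 1) = Nat.fib (b - 1) + Nat.fib b := by
      obtain ⟨c, rfl⟩ : ∃ c, b = c + 1 := ⟨b - 1, by omega⟩
      exact Nat.fib_add_two
    have hmono : Nat.fib (b + 1) ≤ Nat.fib a := Nat.fib_mono hb
    simp only [List.map_cons, List.sum_cons]
    omega

theorem mem_zeckendorf_lt {n a x : ℕ} (h : n < Nat.fib a) (hx : x ∈ n.zeckendorf) : x < a := by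
  by_contra hax
  have h1 : Nat.fib a ≤ Nat.fib x := Nat.fib_mono (by omega)
  have h2 : Nat.fib x ≤ (n.zeckendorf.map Nat.fib).sum :=
    List.le_sum_of_mem (List.mem_map_of_mem hx)
  rw [Nat.sum_zeckendorf_fib] at h2
  omega

/-- Common leading Fibonacci terms are stripped until that of j exceeds what remains of i; then
`sum_fib_add_le` gives the gap. -/
theorem add_fib_le_of_zeckendorf {M : ℕ} (hM : 1 ≤ M) (j : ℕ) :
    ∀ i < j, (∀ x ∈ i.zeckendorf, M ≤ x) → (∀ x ∈ j.zeckendorf, M ≤ x) →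
      i + Nat.fib (M - 1) ≤ j := by
  induction j using Nat.strong_induction_on with
  | _ j ih =>
    intro i hij hi hj
    have hj0 : 0 < j := by omega
    have hgj := Nat.fib_greatestFib_le j
    by_cases hlt : i < Nat.fib j.greatestFib
    · refine le_trans ?_ hgj
      have h := sum_fib_add_le hM i.zeckendorf (Nat.isZeckendorfRep_zeckendorf i) hi j.greatestFib
        ?_ (fun x hx => mem_zeckendorf_lt hlt hx)
      · rwa [Nat.sum_zeckendorf_fib] at h
      · have := hj j.greatestFib (by rw [Nat.zeckendorf_of_pos hj0]; simp)
        omega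
    · have hpos : 0 < Nat.fib j.greatestFib := Nat.fib_pos.2 (Nat.greatestFib_pos.2 hj0)
      have hi0 : 0 < i := by omega
      have heq : i.greatestFib = j.greatestFib :=
        le_antisymm (Nat.greatestFib_mono hij.le) (Nat.le_greatestFib.2 (by omega))
      have h := ih (j - Nat.fib j.greatestFib) (by omega) (i - Nat.fib j.greatestFib) (by omega)
        (fun x hx => hi x (by rw [Nat.zeckendorf_of_pos hi0, heq]; simp [hx]))
        (fun x hx => hj x (by rw [Nat.zeckendorf_of_pos hj0]; simp [hx]))
      omega

theorem le_of_mem_zeckendorf_of_lt_fibWord {m n : ℕ} (h : m < fibWord n) :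
    ∀ x ∈ n.zeckendorf, m + 2 ≤ x := by
  intro x hx
  have hp : (n.zeckendorf ++ [0]).Pairwise (fun a b => b + 2 ≤ a) := by
    have : IsTrans ℕ (fun a b => b + 2 ≤ a) := ⟨fun a b c h1 h2 => by omega⟩
    rw [← List.isChain_iff_pairwise]
    exact Nat.isZeckendorfRep_zeckendorf n
  have hp' := (List.pairwise_append.1 hp).1
  unfold fibWord at h
  have hne : n.zeckendorf ≠ [] := List.ne_nil_of_mem hx
  rw [List.getLastD_eq_getLast?, List.getLast?_eq_some_getLast hne, Option.getD_some] at h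
  have hdl := List.dropLast_append_getLast hne
  rw [← hdl] at hx hp'
  rcases List.mem_append.1 hx with hx | hx
  · have := (List.pairwise_append.1 hp').2.2 x hx _ (List.mem_singleton_self _)
    omega
  · rw [List.mem_singleton] at hx
    omega

theorem largeLettersSpread_fibWord : LargeLettersSpread fibWord := by
  intro g
  -- A letter above g+6 means Zeckendorf indices at least g+8, hence gaps of at least F_{g+7} ≥ g+7;
  -- the last inequality needs an index of at least 5.
  refine ⟨g + 6, fun i j _ hij h1 h2 => ?_⟩
  have h := add_fib_le_of_zeckendorf (M := g + 8) (by omega) j i hij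
    (le_of_mem_zeckendorf_of_lt_fibWord h1) (le_of_mem_zeckendorf_of_lt_fibWord h2)
  have h3 : g + 7 ≤ Nat.fib (g + 7) := Nat.le_fib_self (by omega)
  simp only [Nat.add_succ_sub_one] at h
  omega

/-! ### Coordinates of vertices -/

/-- The index of a star node, and `0` for a path vertex. -/
def Vertex.starIdx : Vertex → ℕ
  | .path _ => 0
  | .star a => a

/-- The index of a path vertex, and `0` for a star node. -/
def Vertex.pathIdx : Vertex → ℕ
  | .path i => i
  | .star _ => 0

theorem Vertex.ext_starIdx {x y : Vertex} (hx : 0 < x.starIdx) (h : x.starIdx = y.starIdx) :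
    x = y := by
  rcases x with i | a <;> rcases y with j | b <;> simp_all [Vertex.starIdx]

theorem Vertex.ext_pathIdx {x y : Vertex} (hx : x.starIdx = 0) (hy : y.starIdx = 0)
    (h : x.pathIdx = y.pathIdx) : x = y := by
  rcases x with i | a <;> rcases y with j | b <;> simp_all [Vertex.starIdx, Vertex.pathIdx]

theorem Vertex.pathIdx_pos {x : Vertex} (hx : x.starIdx = 0) : 0 < x.pathIdx := by
  rcases x with i | a
  · exact i.2
  · exact absurd hx a.2.ne'

theorem adj_starIdx {α : ℕ → ℕ} {x y : Vertex} (h : (pathStarGraph α).Adj x y)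
    (hy : 0 < y.starIdx) : x.starIdx = 0 ∧ α x.pathIdx = y.starIdx := by
  rcases x with i | a <;> rcases y with j | b
  · exact absurd hy (lt_irrefl 0)
  · exact ⟨rfl, h⟩
  · exact absurd hy (lt_irrefl 0)
  · exact absurd h id

theorem adj_of_starIdx {α : ℕ → ℕ} {x y : Vertex} (hx : x.starIdx = 0) (hy : 0 < y.starIdx)
    (h : α x.pathIdx = y.starIdx) : (pathStarGraph α).Adj x y := by
  rcases x with i | a <;> rcases y with j | b
  · exact absurd hy (lt_irrefl 0)
  · exact h
  · exact absurd hx a.2.ne'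
  · exact absurd hx a.2.ne'

theorem adj_pathIdx {α : ℕ → ℕ} {x y : Vertex} (hx : x.starIdx = 0) (hy : y.starIdx = 0) :
    (pathStarGraph α).Adj x y ↔ x.pathIdx + 1 = y.pathIdx ∨ y.pathIdx + 1 = x.pathIdx := by
  rcases x with i | a <;> rcases y with j | b
  · exact Iff.rfl
  · exact absurd hy b.2.ne'
  · exact absurd hx a.2.ne'
  · exact absurd hx a.2.ne'

/-- The star node with index `a` is used by `f`. -/
def HasStar {V : Type} (f : V → Vertex) (a : ℕ) : Prop :=
  0 < a ∧ ∃ v, (f v).starIdx = a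

/-- The path vertex with index `i` is used by `f`. -/
def HasPath {V : Type} (f : V → Vertex) (i : ℕ) : Prop :=
  ∃ v, (f v).starIdx = 0 ∧ (f v).pathIdx = i

theorem HasStar.of_comp {V W : Type} {f : V → Vertex} {e : W → V} {a : ℕ}
    (h : HasStar (f ∘ e) a) : HasStar f a :=
  ⟨h.1, e h.2.choose, h.2.choose_spec⟩

theorem run_length {V : Type} [Finite V] {f : V → Vertex} {i j : ℕ}
    (h : ∀ k, i ≤ k → k ≤ j → HasPath f k) : j < i + Nat.card V := by
  by_cases hij : i ≤ j
  · have hsub : (Finset.Icc i j : Set ℕ) ⊆ Set.range fun v => (f v).pathIdx := by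
      intro k hk
      rw [Finset.coe_Icc] at hk
      obtain ⟨v, _, hv⟩ := h k hk.1 hk.2
      exact ⟨v, hv⟩
    have h1 := Set.ncard_le_ncard hsub (Set.finite_range _)
    have h2 : (Set.range fun v => (f v).pathIdx).ncard ≤ Nat.card V := by
      rw [← Set.image_univ, ← Set.ncard_univ]
      exact Set.ncard_image_le
    rw [Set.ncard_coe_finset, Nat.card_Icc] at h1
    omega
  · omega

/-! ### Subclasses -/

/-- The members of `D` that embed without the first `m` star nodes. -/
def avoidingClass (α : ℕ → ℕ) (D : Set FinGraph) (m : ℕ) : Set FinGraph :=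
  {G | G ∈ D ∧ ∃ f : G.2 ↪g pathStarGraph α, ∀ a, HasStar f a → m < a}

/-- The members of `D` that embed in such a way that the occurrences of the letters of their
star nodes are more than `g` apart. -/
def spreadClass (α : ℕ → ℕ) (D : Set FinGraph) (g : ℕ) : Set FinGraph :=
  {G | G ∈ D ∧ ∃ f : G.2 ↪g pathStarGraph α,
    ∀ i j, 0 < i → i < j → HasStar f (α i) → HasStar f (α j) → i + g < j}

theorem isHereditary_avoidingClass {α : ℕ → ℕ} {D : Set FinGraph} (hD : IsHereditary D) (m : ℕ) :
    IsHereditary (avoidingClass α D m) := by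
  rintro G ⟨hG, f, hf⟩ H ⟨e⟩
  exact ⟨hD G hG H ⟨e⟩, f.comp e, fun a ha => hf a (HasStar.of_comp (e := e) ha)⟩

theorem isHereditary_spreadClass {α : ℕ → ℕ} {D : Set FinGraph} (hD : IsHereditary D) (g : ℕ) :
    IsHereditary (spreadClass α D g) := by
  rintro G ⟨hG, f, hf⟩ H ⟨e⟩
  exact ⟨hD G hG H ⟨e⟩, f.comp e, fun i j h0 hij hi hj =>
    hf i j h0 hij (HasStar.of_comp (e := e) hi) (HasStar.of_comp (e := e) hj)⟩

theorem IsMinimalOfUnboundedTreewidth.eq_of_subset {D E : Set FinGraph}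
    (hD : IsMinimalOfUnboundedTreewidth D) (hE : IsHereditary E) (hED : E ⊆ D)
    (h : ¬ HasBoundedTreewidth E) : E = D := by
  by_contra hne
  exact h (hD.2.2 E hE (hED.ssubset_of_ne hne))

theorem not_hasBoundedTreewidth_avoidingClass {α : ℕ → ℕ} {D : Set FinGraph}
    (hD : IsHereditary D) (hDα : D ⊆ pathStarClass α) (h : ¬ HasBoundedTreewidth D) (m : ℕ) :
    ¬ HasBoundedTreewidth (avoidingClass α D m) := by
  rintro ⟨k, hk⟩
  refine h ⟨k + m, fun G hG => ?_⟩
  obtain ⟨f⟩ := hDα hG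
  obtain ⟨H, e, he⟩ := exists_finGraph_embedding G
    {v | (f v).starIdx = 0 ∨ m < (f v).starIdx}
  have hHD : H ∈ D := hD G hG H ⟨e⟩
  have hH : treewidth H.2 ≤ k := by
    refine hk H ⟨hHD, f.comp e, ?_⟩
    rintro a ⟨ha, v, hv⟩
    have h1 : e v ∈ Set.range e := ⟨v, rfl⟩
    have hv' : (f (e v)).starIdx = a := hv
    rw [he, Set.mem_ofPred_eq, hv'] at h1
    omega
  refine (treewidth_le_add_of_embedding e (m := m) ?_).trans (Nat.add_le_add_right hH m)
  rw [he]
  have h2 : (Finset.Icc 1 m : Set ℕ).ncard = m := by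
    rw [Set.ncard_coe_finset, Nat.card_Icc]; omega
  refine (Set.ncard_le_ncard_of_injOn (t := (Finset.Icc 1 m : Set ℕ)) (fun v => (f v).starIdx)
    ?_ ?_ (Finset.finite_toSet _)).trans h2.le
  · intro v hv
    rw [Set.mem_compl_iff, Set.mem_ofPred_eq] at hv
    rw [Finset.coe_Icc, Set.mem_Icc]
    omega
  · intro v hv w _ hvw
    rw [Set.mem_compl_iff, Set.mem_ofPred_eq] at hv
    exact f.injective (Vertex.ext_starIdx (by omega) hvw)

/-- The core consists of the star nodes, each a block of its own. A run has at most |V| vertices, so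
it cannot contain two occurrences of used letters. -/
theorem treewidth_le_three_of_spread {V : Type} [Finite V] {G : SimpleGraph V} {α : ℕ → ℕ}
    (f : G ↪g pathStarGraph α)
    (hf : ∀ i j, 0 < i → i < j → HasStar f (α i) → HasStar f (α j) → i + Nat.card V < j) :
    treewidth G ≤ 3 := by
  refine treewidth_le_of_core G {v | 0 < (f v).starIdx} (fun v => (f v).starIdx)
    (fun v => (f v).pathIdx) 1 ?_ ?_ ?_ ?_ ?_
  · intro u hu v hv h
    simp only [Set.mem_compl_iff, Set.mem_ofPred_eq, not_lt, Nat.le_zero] at hu hv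
    exact f.injective (Vertex.ext_pathIdx hu hv h)
  · intro u hu v hv h
    simp only [Set.mem_ofPred_eq, not_lt, Nat.le_zero] at hu hv
    exact (adj_pathIdx hu hv).1 (f.map_adj_iff.2 h)
  · intro u hu v hv h
    have := (adj_starIdx (f.map_adj_iff.2 h) hv).1
    simp only [Set.mem_ofPred_eq] at hu
    omega
  · intro u hu v hv hrun x hx y hy hux hvy
    have h1 := adj_starIdx (f.map_adj_iff.2 hux) hx
    have h2 := adj_starIdx (f.map_adj_iff.2 hvy) hy
    have hsx : HasStar f (α (f u).pathIdx) := ⟨h1.2 ▸ hx, x, h1.2.symm⟩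
    have hsy : HasStar f (α (f v).pathIdx) := ⟨h2.2 ▸ hy, y, h2.2.symm⟩
    have hlen := run_length (f := f) (i := min (f u).pathIdx (f v).pathIdx)
      (j := max (f u).pathIdx (f v).pathIdx) (fun k hk1 hk2 => by
        obtain ⟨w, hw, hwk⟩ := hrun k hk1 hk2
        simp only [Set.mem_ofPred_eq, not_lt, Nat.le_zero] at hw
        exact ⟨w, hw, hwk⟩)
    rcases lt_trichotomy (f u).pathIdx (f v).pathIdx with hlt | heq | hlt
    · have := hf _ _ (Vertex.pathIdx_pos h1.1) hlt hsx hsy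
      omega
    · rw [heq] at h1
      omega
    · have := hf _ _ (Vertex.pathIdx_pos h2.1) hlt hsy hsx
      omega
  · intro c
    rw [Set.ncard_le_one]
    rintro a ⟨ha, ha'⟩ b ⟨_, hb'⟩
    exact f.injective (Vertex.ext_starIdx ha (ha'.trans hb'.symm))

theorem not_isMinimal_of_spreadClass {α : ℕ → ℕ} {D : Set FinGraph}
    (hD : IsMinimalOfUnboundedTreewidth D)
    (h : ∀ g, ¬ HasBoundedTreewidth (spreadClass α D g)) : False := by
  refine hD.2.1 ⟨3, fun G hG => ?_⟩
  -- The gap may depend on G, because `D` equals its spread class for every gap.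
  have heq := hD.eq_of_subset (isHereditary_spreadClass hD.1 (Nat.card (Fin G.1)))
    (fun _ h => h.1) (h (Nat.card (Fin G.1)))
  rw [← heq] at hG
  obtain ⟨_, f, hf⟩ := hG
  exact treewidth_le_three_of_spread f hf

theorem not_exists_minimal_of_largeLettersSpread {α : ℕ → ℕ} (hα : LargeLettersSpread α) :
    ¬ ∃ D : Set FinGraph, D ⊆ pathStarClass α ∧ IsMinimalOfUnboundedTreewidth D := by
  rintro ⟨D, hDα, hD⟩
  refine not_isMinimal_of_spreadClass (α := α) hD fun g => ?_
  obtain ⟨m, hm⟩ := hα g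
  have h := not_hasBoundedTreewidth_avoidingClass hD.1 hDα hD.2.1 m
  rintro ⟨k, hk⟩
  refine h ⟨k, fun G hG => hk G ?_⟩
  obtain ⟨hGD, f, hf⟩ := hG
  exact ⟨hGD, f, fun i j h0 hij hi hj => hm i j h0 hij (hf _ hi) (hf _ hj)⟩

/-! ### The arithmetic word -/

/-- `L` path segments, each running through the same `L + 1` star nodes `a 0 < ⋯ < a L`. -/
structure Window {V : Type} (f : V → Vertex) (L : ℕ) where
  letter : ℕ → ℕ
  hasStar : ∀ r ≤ L, HasStar f (letter r)
  strictMono : ∀ r s, r < s → s ≤ L → letter r < letter s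
  start : Set ℕ
  le_ncard : L ≤ start.ncard
  hasPath : ∀ i ∈ start, ∀ k, i ≤ k → k ≤ i + (letter L - letter 0) → HasPath f k
  word_start : ∀ i ∈ start, arithWord i = letter 0
  word_end : ∀ i ∈ start, arithWord (i + (letter L - letter 0)) = letter L

/-- `Nat.count P b` serves as the rank of b among the elements of P, starting from 0. -/
theorem exists_count_eq {P : ℕ → Prop} [DecidablePred P] {y n : ℕ} (hy : P y)
    (hn : n ≤ Nat.count P y) : ∃ b ≤ y, P b ∧ Nat.count P b = n := by
  have hex : ∃ b, n < Nat.count P (b + 1) := ⟨y, by rw [Nat.count_succ, if_pos hy]; omega⟩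
  refine ⟨Nat.find hex, Nat.find_min' hex (by rw [Nat.count_succ, if_pos hy]; omega), ?_⟩
  have h1 := Nat.find_spec hex
  have h2 : Nat.count P (Nat.find hex) ≤ n := by
    rcases Nat.eq_zero_or_pos (Nat.find hex) with h | h
    · rw [h, Nat.count_zero]; omega
    · have := Nat.find_min hex (m := Nat.find hex - 1) (by omega)
      rw [Nat.sub_add_cancel h] at this
      omega
  rw [Nat.count_succ] at h1
  split_ifs at h1 with hb
  · exact ⟨hb, by omega⟩
  · omega

/-! ### Runs of the path and blocks of L star nodes -/

section Runs

variable {V : Type} [Finite V] {f : V → Vertex} {m : ℕ}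

theorem arithWord_run (hm : Nat.card V ≤ m) (hf : ∀ a, HasStar f a → m < a) {i j k : ℕ}
    (hik : i ≤ k) (hkj : k ≤ j) (hrun : ∀ k, i ≤ k → k ≤ j → HasPath f k)
    (hj : HasStar f (arithWord j)) : arithWord k + (j - k) = arithWord j := by
  have h1 := run_length hrun
  have h2 := arithWord_add k (j - k)
  rw [Nat.add_sub_cancel' hkj] at h2
  have := hf _ hj
  omega

open Classical in
/-- `i` is the start of a segment passing through all star nodes of a block of size `L`. -/
def IsBlockStart (f : V → Vertex) (L i : ℕ) : Prop :=
  HasStar f (arithWord i) ∧ L ∣ Nat.count (HasStar f) (arithWord i) ∧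
    ∃ j, i < j ∧ (∀ k, i ≤ k → k ≤ j → HasPath f k) ∧ HasStar f (arithWord j) ∧
      Nat.count (HasStar f) (arithWord j) = Nat.count (HasStar f) (arithWord i) + L

-- Letters increase along the run, so only e < e' matters. A rise by two blocks would make the run
-- cross an entire block, whose start would lie strictly between e and e'.
open Classical in
theorem block_le_of_run (hm : Nat.card V ≤ m) (hf : ∀ a, HasStar f a → m < a) {L : ℕ}
    (hL : 0 < L) {e e' : ℕ} (hrun : ∀ k, min e e' ≤ k → k ≤ max e e' → HasPath f k)
    (he : HasStar f (arithWord e)) (he' : HasStar f (arithWord e'))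
    (hZ : ∀ k, min e e' < k → k < max e e' → ¬ IsBlockStart f L k) :
    Nat.count (HasStar f) (arithWord e') / L ≤ Nat.count (HasStar f) (arithWord e) / L + 1 := by
  rcases le_or_gt e' e with hle | hlt
  · rw [min_eq_right hle, max_eq_left hle] at hrun
    have h1 := arithWord_run hm hf le_rfl hle hrun he
    have h2 : Nat.count (HasStar f) (arithWord e') ≤ Nat.count (HasStar f) (arithWord e) :=
      Nat.count_monotone _ (by omega)
    exact (Nat.div_le_div_right h2).trans (Nat.le_succ _)
  · rw [min_eq_left hlt.le, max_eq_right hlt.le] at hrun hZ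
    by_contra hcon
    set q := Nat.count (HasStar f) (arithWord e) / L + 1 with hq
    have h1 : Nat.count (HasStar f) (arithWord e) < q * L := Nat.lt_mul_of_div_lt (by omega) hL
    have h2 : (q + 1) * L ≤ Nat.count (HasStar f) (arithWord e') :=
      (Nat.le_div_iff_mul_le hL).1 (by omega)
    have h3 : (q + 1) * L = q * L + L := Nat.succ_mul q L
    obtain ⟨b, hb, hbP, hbc⟩ := exists_count_eq he' (n := q * L) (by omega)
    obtain ⟨b', hb', hbP', hbc'⟩ := exists_count_eq he' (n := (q + 1) * L) h2
    have heb : arithWord e < b := by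
      by_contra h
      have := Nat.count_monotone (HasStar f) (not_lt.1 h)
      omega
    have hbb : b < b' := by
      by_contra h
      have := Nat.count_monotone (HasStar f) (not_lt.1 h)
      omega
    have hee := arithWord_run hm hf le_rfl hlt.le hrun he'
    obtain ⟨i, hi1, hi2⟩ : ∃ i, i + (arithWord e' - b) = e' ∧ e < i :=
      ⟨e + (b - arithWord e), by omega, by omega⟩
    obtain ⟨j, hj1, hj2⟩ : ∃ j, j + (arithWord e' - b') = e' ∧ i < j :=
      ⟨e + (b' - arithWord e), by omega, by omega⟩
    have hwi := arithWord_run hm hf (k := i) (by omega) (by omega) hrun he'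
    have hwj := arithWord_run hm hf (k := j) (by omega) (by omega) hrun he'
    have hib : arithWord i = b := by omega
    have hjb : arithWord j = b' := by omega
    refine hZ i hi2 (by omega) ⟨hib ▸ hbP, ?_, j, hj2, fun k h1 h2 => hrun k (by omega) (by omega),
      hjb ▸ hbP', ?_⟩
    · rw [hib, hbc]
      exact Dvd.intro_left q rfl
    · rw [hib, hjb, hbc, hbc', h3]

-- Rank determines a used letter, so segments starting at the same rank n pass through the same star
-- nodes, those of ranks n, …, n+L.
open Classical in
theorem nonempty_window_of_ncard (hm : Nat.card V ≤ m) (hf : ∀ a, HasStar f a → m < a) {L : ℕ}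
    (hL : 0 < L) {n : ℕ} {Z : Set ℕ}
    (hZ : ∀ i ∈ Z, IsBlockStart f L i ∧ Nat.count (HasStar f) (arithWord i) = n)
    (hcard : L ≤ Z.ncard) : Nonempty (Window f L) := by
  obtain ⟨i₀, hi₀⟩ : Z.Nonempty := by
    rw [Set.nonempty_iff_ne_empty]
    rintro rfl
    rw [Set.ncard_empty] at hcard
    omega
  have hex : ∀ r, ∃ b, r ≤ L → HasStar f b ∧ Nat.count (HasStar f) b = n + r := by
    intro r
    obtain ⟨⟨_, _, j, _, _, hjP, hjc⟩, hin⟩ := hZ i₀ hi₀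
    by_cases hr : r ≤ L
    · obtain ⟨b, _, h1, h2⟩ := exists_count_eq hjP (n := n + r) (by omega)
      exact ⟨b, fun _ => ⟨h1, h2⟩⟩
    · exact ⟨0, fun h => absurd h hr⟩
  choose a ha using hex
  have key : ∀ i ∈ Z, arithWord i = a 0 ∧ ∃ j, i < j ∧ (∀ k, i ≤ k → k ≤ j → HasPath f k) ∧
      arithWord j = a L ∧ j = i + (a L - a 0) := by
    intro i hi
    obtain ⟨⟨hiP, _, j, hij, hrun, hjP, hjc⟩, hin⟩ := hZ i hi
    have h0 : arithWord i = a 0 :=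
      Nat.count_injective hiP (ha 0 (Nat.zero_le _)).1 (by rw [hin, (ha 0 (Nat.zero_le _)).2]; rfl)
    have hLL : arithWord j = a L :=
      Nat.count_injective hjP (ha L le_rfl).1 (by rw [hjc, hin, (ha L le_rfl).2])
    have := arithWord_run hm hf le_rfl hij.le hrun hjP
    exact ⟨h0, j, hij, hrun, hLL, by omega⟩
  exact ⟨{ letter := a
           hasStar := fun r hr => (ha r hr).1
           strictMono := fun r s hrs hs => by
             by_contra h
             have h1 := Nat.count_monotone (HasStar f) (not_lt.1 h)
             rw [(ha s hs).2, (ha r (by omega)).2] at h1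
             omega
           start := Z
           le_ncard := hcard
           hasPath := fun i hi k h1 h2 => by
             obtain ⟨_, j, _, hrun, _, hj⟩ := key i hi
             exact hrun k h1 (by omega)
           word_start := fun i hi => (key i hi).1
           word_end := fun i hi => by
             obtain ⟨_, j, _, _, hj, hj'⟩ := key i hi
             rw [← hj', hj] }⟩

end Runs

-- The core consists of the star nodes and the path vertices at block starts, grouped by rank
-- divided by L. A block has at most L star nodes and, if no window exists, at most L starts, so
-- `treewidth_le_of_core` applies with M = 2L.
open Classical in
theorem exists_window {V : Type} [Finite V] {G : SimpleGraph V} (f : G ↪g pathStarGraph arithWord)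
    {m : ℕ} (hm : Nat.card V ≤ m) (hf : ∀ a, HasStar f a → m < a) {L : ℕ} (hL : 0 < L)
    (htw : 2 * (2 * L) + 1 < treewidth G) : Nonempty (Window f L) := by
  by_contra hno
  refine htw.not_ge ?_
  let key : V → ℕ := fun v =>
    if 0 < (f v).starIdx then (f v).starIdx else arithWord (f v).pathIdx
  have key_star : ∀ v, 0 < (f v).starIdx → key v = (f v).starIdx := fun v h => if_pos h
  have key_path : ∀ v, (f v).starIdx = 0 → key v = arithWord (f v).pathIdx := fun v h =>
    if_neg (by omega)
  let core : Set V := {v | 0 < (f v).starIdx ∨ IsBlockStart f L (f v).pathIdx}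
  have hnot : ∀ v, v ∉ core → (f v).starIdx = 0 ∧ ¬ IsBlockStart f L (f v).pathIdx := by
    intro v hv
    simp only [core, Set.mem_ofPred_eq, not_or] at hv
    exact ⟨by omega, hv.2⟩
  -- The position e is that of u if x is a star node and that of x if x is a block start, so a run
  -- may be extended by a core vertex at either end.
  have hatt : ∀ u, (f u).starIdx = 0 → ∀ x ∈ core, G.Adj u x →
      ∃ e, HasPath f e ∧ HasStar f (arithWord e) ∧ arithWord e = key x ∧
        (f u).pathIdx ≤ e + 1 ∧ e ≤ (f u).pathIdx + 1 := by
    intro u hu x hx hux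
    have hadj := f.map_adj_iff.2 hux
    rcases Nat.eq_zero_or_pos (f x).starIdx with h0 | h0
    · have h1 := (adj_pathIdx hu h0).1 hadj
      have hZ : IsBlockStart f L (f x).pathIdx := hx.resolve_left (by omega)
      exact ⟨(f x).pathIdx, ⟨x, h0, rfl⟩, hZ.1, (key_path x h0).symm, by omega, by omega⟩
    · have h1 := adj_starIdx hadj h0
      exact ⟨(f u).pathIdx, ⟨u, hu, rfl⟩, ⟨h1.2 ▸ h0, x, h1.2.symm⟩,
        h1.2.trans (key_star x h0).symm, by omega, by omega⟩
  refine treewidth_le_of_core G core (fun v => Nat.count (HasStar f) (key v) / L)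
    (fun v => (f v).pathIdx) (2 * L) ?_ ?_ ?_ ?_ ?_
  · intro u hu v hv h
    exact f.injective (Vertex.ext_pathIdx (hnot u hu).1 (hnot v hv).1 h)
  · intro u hu v hv h
    exact (adj_pathIdx (hnot u hu).1 (hnot v hv).1).1 (f.map_adj_iff.2 h)
  · intro u hu v hv h
    have hadj := f.map_adj_iff.2 h
    rcases Nat.eq_zero_or_pos (f v).starIdx with h0 | h0
    · rcases Nat.eq_zero_or_pos (f u).starIdx with h0' | h0'
      · have h1 := (adj_pathIdx h0' h0).1 hadj
        have hZu : IsBlockStart f L (f u).pathIdx := hu.resolve_left (by omega)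
        have hZv : IsBlockStart f L (f v).pathIdx := hv.resolve_left (by omega)
        simp only [key_path u h0', key_path v h0]
        refine block_le_of_run hm hf hL (fun k hk1 hk2 => ?_) hZu.1 hZv.1
          (fun k hk1 hk2 => by omega)
        rcases (by omega : k = (f u).pathIdx ∨ k = (f v).pathIdx) with rfl | rfl
        · exact ⟨u, h0', rfl⟩
        · exact ⟨v, h0, rfl⟩
      · have h1 := adj_starIdx hadj.symm h0'
        simp only [key_path v h0, key_star u h0', h1.2]
        omega
    · have h1 := adj_starIdx hadj h0
      simp only [key_path u h1.1, key_star v h0, h1.2]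
      omega
  · intro u hu v hv hrun x hx y hy hux hvy
    obtain ⟨e, he1, he2, he3, he4, he5⟩ := hatt u (hnot u hu).1 x hx hux
    obtain ⟨e', he1', he2', he3', he4', he5'⟩ := hatt v (hnot v hv).1 y hy hvy
    simp only [← he3, ← he3']
    refine block_le_of_run hm hf hL (fun k hk1 hk2 => ?_) he2 he2' (fun k hk1 hk2 => ?_)
    · by_cases hke : k = e
      · exact hke ▸ he1
      by_cases hke' : k = e'
      · exact hke' ▸ he1'
      obtain ⟨w, hw, hwk⟩ := hrun k (by omega) (by omega)
      exact ⟨w, (hnot w hw).1, hwk⟩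
    · obtain ⟨w, hw, hwk⟩ := hrun k (by omega) (by omega)
      exact hwk ▸ (hnot w hw).2
  · intro c
    have hsub : {v | v ∈ core ∧ Nat.count (HasStar f) (key v) / L = c} ⊆
        {v | 0 < (f v).starIdx ∧ Nat.count (HasStar f) (f v).starIdx / L = c} ∪
        {v | (f v).starIdx = 0 ∧ IsBlockStart f L (f v).pathIdx ∧
          Nat.count (HasStar f) (arithWord (f v).pathIdx) / L = c} := by
      rintro v ⟨hv, hvc⟩
      rcases Nat.eq_zero_or_pos (f v).starIdx with h0 | h0
      · rw [key_path v h0] at hvc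
        exact Or.inr ⟨h0, hv.resolve_left (by omega), hvc⟩
      · rw [key_star v h0] at hvc
        exact Or.inl ⟨h0, hvc⟩
    refine (Set.ncard_le_ncard hsub).trans ((Set.ncard_union_le _ _).trans ?_)
    have h1 : {v | 0 < (f v).starIdx ∧
        Nat.count (HasStar f) (f v).starIdx / L = c}.ncard ≤ L := by
      have h2 : (Finset.Ico (c * L) (c * L + L) : Set ℕ).ncard = L := by
        rw [Set.ncard_coe_finset, Nat.card_Ico]; omega
      refine (Set.ncard_le_ncard_of_injOn (t := (Finset.Ico (c * L) (c * L + L) : Set ℕ))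
        (fun v => Nat.count (HasStar f) (f v).starIdx) ?_ ?_ (Finset.finite_toSet _)).trans h2.le
      · rintro v ⟨_, hv⟩
        rw [Finset.coe_Ico, Set.mem_Ico]
        have h3 := Nat.div_mul_le_self (Nat.count (HasStar f) (f v).starIdx) L
        have h4 := Nat.lt_div_mul_add hL (a := Nat.count (HasStar f) (f v).starIdx)
        rw [hv] at h3 h4
        exact ⟨h3, h4⟩
      · rintro v ⟨hv, _⟩ w ⟨hw, _⟩ hvw
        exact f.injective (Vertex.ext_starIdx hv
          (Nat.count_injective (p := HasStar f) ⟨hv, v, rfl⟩ ⟨hw, w, rfl⟩ hvw))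
    set Z : Set V := {v | (f v).starIdx = 0 ∧ IsBlockStart f L (f v).pathIdx ∧
      Nat.count (HasStar f) (arithWord (f v).pathIdx) / L = c}
    have h2 : Z.ncard ≤ L := by
      by_contra hlt
      refine hno (nonempty_window_of_ncard hm hf hL (n := c * L)
        (Z := (fun v => (f v).pathIdx) '' Z) ?_ ?_)
      · rintro _ ⟨v, ⟨_, hv, hvc⟩, rfl⟩
        exact ⟨hv, by rw [← hvc, Nat.div_mul_cancel hv.2.1]⟩
      · rw [Set.InjOn.ncard_image]
        · omega
        · rintro v ⟨hv, _⟩ w ⟨hw, _⟩ hvw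
          exact f.injective (Vertex.ext_pathIdx hv hw hvw)
    omega

/-! ### Thinning the star nodes of a window -/

theorem connected_induce_segment {V : Type} {H : SimpleGraph V} {α : ℕ → ℕ}
    (f : H ↪g pathStarGraph α) {i d : ℕ} (h : ∀ k, i ≤ k → k ≤ i + d → HasPath f k) :
    (H.induce {v | (f v).starIdx = 0 ∧ i ≤ (f v).pathIdx ∧ (f v).pathIdx ≤ i + d}).Connected := by
  set Q : Set V := {v | (f v).starIdx = 0 ∧ i ≤ (f v).pathIdx ∧ (f v).pathIdx ≤ i + d} with hQ
  obtain ⟨w, hw, hwi⟩ := h i le_rfl (by omega)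
  have hwQ : w ∈ Q := ⟨hw, by omega, by omega⟩
  have key : ∀ n, ∀ v (hv : v ∈ Q), (f v).pathIdx = i + n →
      (H.induce Q).Reachable ⟨v, hv⟩ ⟨w, hwQ⟩ := by
    intro n
    induction n with
    | zero =>
      intro v hv hvn
      have : v = w := f.injective (Vertex.ext_pathIdx hv.1 hw (by omega))
      subst this
      rfl
    | succ n ih =>
      intro v hv hvn
      have hvd := hv.2.2
      obtain ⟨u, hu, hun⟩ := h (i + n) (by omega) (by omega)
      have huQ : u ∈ Q := ⟨hu, by omega, by omega⟩
      have hadj : H.Adj v u := f.map_adj_iff.1 ((adj_pathIdx hv.1 hu).2 (by omega))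
      exact SimpleGraph.Reachable.trans
        (SimpleGraph.Adj.reachable (G := H.induce Q) (u := ⟨v, hv⟩) (v := ⟨u, huQ⟩) hadj)
        (ih u huQ hun)
  rw [SimpleGraph.connected_iff]
  refine ⟨fun x y => ?_, ⟨⟨w, hwQ⟩⟩⟩
  have hr : ∀ x : Q, (H.induce Q).Reachable x ⟨w, hwQ⟩ := fun x =>
    key ((f x.1).pathIdx - i) x.1 x.2 (by have := x.2.2.1; omega)
  exact (hr x).trans (hr y).symm

theorem Window.word_eq {V : Type} [Finite V] {f : V → Vertex} {m L : ℕ} (w : Window f L)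
    (hm : Nat.card V ≤ m) (hf : ∀ a, HasStar f a → m < a) {i d : ℕ} (hi : i ∈ w.start)
    (hd : d ≤ w.letter L - w.letter 0) : arithWord (i + d) = w.letter 0 + d := by
  have h := arithWord_run hm hf (k := i + d) (by omega) (Nat.add_le_add_left hd i)
    (w.hasPath i hi) (by rw [w.word_end i hi]; exact w.hasStar L le_rfl)
  rw [w.word_end i hi] at h
  have h0 := arithWord_run hm hf (k := i) le_rfl (by omega)
    (w.hasPath i hi) (by rw [w.word_end i hi]; exact w.hasStar L le_rfl)
  rw [w.word_end i hi, w.word_start i hi] at h0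
  omega

/-- Of the star nodes, only every (g+1)-st one of the window is kept, and all path vertices are
kept. With K of the segments they form a complete bipartite minor. -/
theorem exists_spread_subgraph {G : FinGraph} (f : G.2 ↪g pathStarGraph arithWord) {m g K : ℕ}
    (hm : Nat.card (Fin G.1) ≤ m) (hg : g ≤ m) (hf : ∀ a, HasStar f a → m < a)
    (w : Window f ((g + 1) * K)) :
    ∃ (H : FinGraph) (e : H.2 ↪g G.2), K ≤ treewidth H.2 + 1 ∧
      ∀ i j, 0 < i → i < j → HasStar (f.comp e) (arithWord i) →
        HasStar (f.comp e) (arithWord j) → i + g < j := by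
  set L := (g + 1) * K with hL
  let s : ℕ → ℕ := fun j => w.letter ((g + 1) * j)
  have hsL : ∀ j < K, (g + 1) * j ≤ L := fun j hj => Nat.mul_le_mul_left _ hj.le
  have hgap : ∀ r d, r + d ≤ L → w.letter r + d ≤ w.letter (r + d) := by
    intro r d
    induction d with
    | zero => intro _; exact le_rfl
    | succ d ih =>
      intro h
      have := ih (by omega)
      have := w.strictMono (r + d) (r + (d + 1)) (by omega) h
      omega
  have hs : ∀ j k, j < k → k < K → s j + (g + 1) ≤ s k := by
    intro j k hjk hk
    have h1 : (g + 1) * j + (g + 1) ≤ (g + 1) * k := Nat.mul_le_mul_left (g + 1) hjk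
    obtain ⟨d, hd⟩ := Nat.exists_eq_add_of_le (Nat.le_of_add_right_le h1)
    have h2 := hgap ((g + 1) * j) d (by have := hsL k hk; omega)
    simp only [s]
    rw [hd]
    omega
  have hs0 : ∀ j < K, w.letter 0 ≤ s j ∧ s j ≤ w.letter L := by
    intro j hj
    have h1 := hgap 0 ((g + 1) * j) (by have := hsL j hj; omega)
    obtain ⟨d, hd⟩ := Nat.exists_eq_add_of_le (hsL j hj)
    have h2 := hgap ((g + 1) * j) d hd.ge
    rw [Nat.zero_add] at h1
    rw [← hd] at h2
    simp only [s]
    omega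
  obtain ⟨H, e, he⟩ := exists_finGraph_embedding G
    {v | (f v).starIdx = 0 ∨ ∃ j < K, (f v).starIdx = s j}
  have hlift : ∀ v, ((f v).starIdx = 0 ∨ ∃ j < K, (f v).starIdx = s j) → ∃ x, e x = v := by
    intro v hv
    have : v ∈ Set.range e := by rw [he]; exact hv
    exact this
  have hstar : ∀ a, HasStar (f.comp e) a → ∃ j < K, a = s j := by
    rintro a ⟨ha, x, hx⟩
    have h1 : e x ∈ Set.range e := ⟨x, rfl⟩
    have hx' : (f (e x)).starIdx = a := hx
    rw [he, Set.mem_ofPred_eq, hx'] at h1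
    exact h1.resolve_left (by omega)
  have hpath : ∀ k, HasPath f k → HasPath (f.comp e) k := by
    rintro k ⟨v, hv, hvk⟩
    obtain ⟨x, rfl⟩ := hlift v (Or.inl hv)
    exact ⟨x, hv, hvk⟩
  refine ⟨H, e, ?_, ?_⟩
  · have hKL : K ≤ w.start.ncard :=
      (Nat.le_mul_of_pos_left K (Nat.succ_pos g)).trans w.le_ncard
    obtain ⟨S, hS, hSc⟩ := Set.exists_subset_card_eq hKL
    -- Infinite sets have `ncard` 0, so the cardinality alone does not give finiteness when K = 0.
    have hfin : S.Finite := by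
      by_contra h
      rw [Set.Infinite.ncard h] at hSc
      subst hSc
      exact h (by
        have : (w.start ∩ S).Finite := by
          refine (Set.finite_range fun v : Fin G.1 => (f v).pathIdx).subset ?_
          rintro i ⟨hi, _⟩
          obtain ⟨v, _, hv⟩ := w.hasPath i hi i le_rfl (by omega)
          exact ⟨v, hv⟩
        rwa [Set.inter_eq_right.2 hS] at this)
    have : Finite S := hfin
    let φ : Fin K ≃ S := (Finite.equivFinOfCardEq (by rw [Nat.card_coe_set_eq, hSc])).symm
    have hφ : ∀ k, (φ k : ℕ) ∈ w.start := fun k => hS (φ k).2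
    have hvert : ∀ j : Fin K, ∃ x, ((f.comp e) x).starIdx = s j := by
      intro j
      obtain ⟨v, hv⟩ := (w.hasStar _ (hsL j j.2)).2
      obtain ⟨x, rfl⟩ := hlift v (Or.inr ⟨j, j.2, hv⟩)
      exact ⟨x, hv⟩
    choose y hy using hvert
    have hspos : ∀ j : Fin K, 0 < s j := fun j => (w.hasStar _ (hsL j j.2)).1
    refine le_treewidth_of_completeBipartite_minor H.2
      (fun k => {v | ((f.comp e) v).starIdx = 0 ∧ (φ k : ℕ) ≤ ((f.comp e) v).pathIdx ∧
        ((f.comp e) v).pathIdx ≤ φ k + (w.letter L - w.letter 0)})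
      (fun k => connected_induce_segment (f.comp e)
        fun n h1 h2 => hpath n (w.hasPath _ (hφ k) n h1 h2)) ?_ y ?_ ?_
    -- Letters increase strictly along a segment, so `letter 0` occurs only at its start and no
    -- other segment can start inside it.
    · have haux : ∀ k l : Fin K, ∀ p : ℕ, (φ k : ℕ) < φ l → (φ l : ℕ) ≤ p →
          p ≤ φ k + (w.letter L - w.letter 0) → False := by
        intro k l p h1 h2 h3
        have h4 := w.word_eq hm hf (hφ k) (d := φ l - φ k) (by omega)
        rw [Nat.add_sub_cancel' h1.le, w.word_start _ (hφ l)] at h4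
        omega
      rintro k l v ⟨_, h1, h2⟩ ⟨_, h3, h4⟩
      rcases lt_trichotomy (φ k : ℕ) (φ l) with h | h | h
      · exact (haux k l _ h h3 h2).elim
      · exact φ.injective (Subtype.ext h)
      · exact (haux l k _ h h1 h4).elim
    · intro j k hjk
      have h1 : s j = s k := by rw [← hy j, ← hy k, hjk]
      rcases lt_trichotomy j k with h | h | h
      · have := hs j k h k.2; omega
      · exact h
      · have := hs k j h j.2; omega
    · intro k j
      have h0 := hs0 j j.2
      obtain ⟨x, hx, hxp⟩ := hpath _ (w.hasPath _ (hφ k) (φ k + (s j - w.letter 0)) (by omega)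
        (by omega))
      refine ⟨x, ⟨hx, by omega, by omega⟩, (f.comp e).map_adj_iff.1 (adj_of_starIdx hx ?_ ?_)⟩
      · rw [hy]; exact hspos j
      · rw [hy, hxp, w.word_eq hm hf (hφ k) (by omega)]
        omega
  · intro i j _ hij hi hj
    obtain ⟨k, hk, hik⟩ := hstar _ hi
    obtain ⟨l, hl, hjl⟩ := hstar _ hj
    -- The letter at j exceeds m ≥ g, so within distance g there is no reset and the two letters
    -- differ by j - i; kept letters that are distinct differ by at least g+1.
    have hbig := hf _ (HasStar.of_comp (e := e) hj)
    by_contra hle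
    have h := arithWord_add i (j - i)
    rw [Nat.add_sub_cancel' hij.le] at h
    rcases lt_trichotomy k l with hkl | hkl | hkl
    · have := hs k l hkl hl; omega
    · subst hkl; omega
    · have := hs l k hkl hk; omega

theorem not_exists_minimal_arithWord :
    ¬ ∃ D : Set FinGraph, D ⊆ pathStarClass arithWord ∧ IsMinimalOfUnboundedTreewidth D := by
  rintro ⟨D, hDα, hD⟩
  refine not_isMinimal_of_spreadClass (α := arithWord) hD ?_
  rintro g ⟨k, hk⟩
  have hpos : 0 < (g + 1) * (k + 2) := Nat.mul_pos (Nat.succ_pos _) (Nat.succ_pos _)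
  -- With K = k+2 the bipartite minor forces tree-width at least k+1, against the assumed bound k.
  refine hD.2.1 ⟨2 * (2 * ((g + 1) * (k + 2))) + 1, fun G hG => ?_⟩
  by_contra htw
  have heq := hD.eq_of_subset
    (isHereditary_avoidingClass (α := arithWord) hD.1 (max (Nat.card (Fin G.1)) g))
    (fun _ h => h.1) (not_hasBoundedTreewidth_avoidingClass hD.1 hDα hD.2.1 _)
  have hG' := hG
  rw [← heq] at hG'
  obtain ⟨_, f, hf⟩ := hG'
  obtain ⟨w⟩ := exists_window f (le_max_left _ _) hf hpos (not_le.1 htw)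
  obtain ⟨H, e, hH, hspread⟩ := exists_spread_subgraph f (le_max_left _ _) (le_max_right _ _) hf w
  have := hk H ⟨hD.1 G hG H ⟨e⟩, f.comp e, hspread⟩
  omega

end PathStar

theorem mainTheorem2 :
    (¬ ∃ D : Set PathStar.FinGraph,
      D ⊆ PathStar.pathStarClass PathStar.arithWord ∧
        PathStar.IsMinimalOfUnboundedTreewidth D) ∧
    (∀ q : ℕ, 2 ≤ q →
      ¬ ∃ D : Set PathStar.FinGraph,
        D ⊆ PathStar.pathStarClass (PathStar.powerWord q) ∧
          PathStar.IsMinimalOfUnboundedTreewidth D) ∧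
    (¬ ∃ D : Set PathStar.FinGraph,
      D ⊆ PathStar.pathStarClass PathStar.fibWord ∧
        PathStar.IsMinimalOfUnboundedTreewidth D) :=
  ⟨PathStar.not_exists_minimal_arithWord,
    fun _ hq => PathStar.not_exists_minimal_of_largeLettersSpread
      (PathStar.largeLettersSpread_powerWord hq),
    PathStar.not_exists_minimal_of_largeLettersSpread PathStar.largeLettersSpread_fibWord⟩
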